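/- Let $d\ge 2$ and let $n,k,r,t,s$ be non-negative integers. An $[n,k]$ quantum code (of local dimension $d$) is a subspace $\mathcal C\subseteq(\mathbb C^d)^{\otimes n}$ of dimension $d^k$. It is an $(r,t,s)$-quantum locally recoverable code (qLRC) if every qudit $j\in[n]=\{1,\dots,n\}$ has $t$ recovery sets $\Gamma_1(j),\dots,\Gamma_t(j)\subseteq[n]$ such that 1. $j\in\Gamma_l(j)$ and $|\Gamma_l(j)|\le r+1$ for every $l\in[t]$; 2. for every $l\in[t]$ there is a quantum channel (completely positive trace-preserving map) $\mathrm{Rec}_{l,j}$ from operators on the qudits of $\Gamma_l(j)\setminus\{j\}$ to operators on the qudits of $\Gamma_l(j)$ such that, extended by the identity on the qudits outside $\Gamma_l(j)$, it satisfies $\mathrm{Rec}_{l,j}\big(\mathrm{Tr}_j(|\psi\rangle\langle\psi|)\big)=|\psi\rangle\langle\psi|$ for every unit vector $\psi\in\mathcal C$, where $\mathrm{Tr}_j$ is the partial trace over qudit $j$; 3. $|\Gamma_{l_1}(j)\cap\Gamma_{l_2}(j)|\le s+1$ for all $l_1\ne l_2$ in $[t]$. For $1\le L\le t$ put $x_L=\min\{L,\lfloor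 r/s\rfloor+1\}$ (with $x_L=L$ if $s=0$), $$\underline N(r,L,s)=\frac{2r-(x_L-1)s}{2}\,x_L+1,\qquad \overline N(r,L,s)=Lr+1,$$ and $$p_2=p_2(r,t,s)=\sum_{\substack{1\le L\le t\\ L\text{ odd}}}\binom tL\frac1{\overline N(r,L,s)}-\sum_{\substack{1\le L\le t\\ L\text{ even}}}\binom tL\frac1{\underline N(r,L,s)}.$$ **Theorem.** If $\mathcal C$ is an $[n,k]$ quantum code that is an $(r,t,s)$-qLRC, then $$k\le n-\lceil n p_2\rceil-\big\lceil (n-\lceil n p_2\rceil)\,p_2\big\rceil .$$ -/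

import Mathlib

open scoped Matrix ComplexOrder

namespace QLRC

/-- For a linear map `Φ` from operators on `ℂ^α` to operators on `ℂ^β`, the map `id ⊗ Φ` from
operators on `ℂ^E ⊗ ℂ^α` to operators on `ℂ^E ⊗ ℂ^β`: it applies `Φ` to every block
`(⟨e| ⊗ 1) M (|f⟩ ⊗ 1)`, `e, f ∈ E`. -/
def ampliation {E α β : Type*} (Φ : Matrix α α ℂ →ₗ[ℂ] Matrix β β ℂ)
    (M : Matrix (E × α) (E × α) ℂ) : Matrix (E × β) (E × β) ℂ :=
  Matrix.of fun p q => Φ (Matrix.of fun a b => M (p.1, a) (q.1, b)) p.2 q.2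

/-- Quantum channels: completely positive trace-preserving linear maps. -/
structure IsQuantumChannel {α β : Type*} [Fintype α] [Fintype β]
    (Φ : Matrix α α ℂ →ₗ[ℂ] Matrix β β ℂ) : Prop where
  completelyPositive : ∀ (m : ℕ) (M : Matrix (Fin m × α) (Fin m × α) ℂ),
    M.PosSemidef → (ampliation Φ M).PosSemidef
  tracePreserving : ∀ X : Matrix α α ℂ, (Φ X).trace = X.trace

/-- The Hilbert space `(ℂ^d)^{⊗ n}` of `n` qudits, through its computational basis
`|x⟩ = |x 0⟩ ⊗ ⋯ ⊗ |x (n-1)⟩`, `x : Fin n → Fin d`. -/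
abbrev QuditSpace (d n : ℕ) : Type := EuclideanSpace ℂ (Fin n → Fin d)

/-- The rank-one operator `|ψ⟩⟨ψ|`. -/
noncomputable def ketBra {d n : ℕ} (ψ : QuditSpace d n) :
    Matrix (Fin n → Fin d) (Fin n → Fin d) ℂ :=
  Matrix.of fun x y => ψ x * star (ψ y)

/-- The basis label on all qudits that is `a` on qudit `j` and `u` on the others. -/
def insertAt {d n : ℕ} (j : Fin n) (a : Fin d) (u : {i : Fin n // i ≠ j} → Fin d) :
    Fin n → Fin d :=
  fun i => if h : i = j then a else u ⟨i, h⟩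

/-- The partial trace over qudit `j`, an operator on the remaining `n - 1` qudits. -/
noncomputable def traceOut {d n : ℕ} (j : Fin n)
    (ρ : Matrix (Fin n → Fin d) (Fin n → Fin d) ℂ) :
    Matrix ({i : Fin n // i ≠ j} → Fin d) ({i : Fin n // i ≠ j} → Fin d) ℂ :=
  Matrix.of fun u v => ∑ a : Fin d, ρ (insertAt j a u) (insertAt j a v)

/-- Restriction of a basis label of all qudits to the qudits outside and inside `S`. -/
def splitLabel {d n : ℕ} (S : Finset (Fin n)) (x : Fin n → Fin d) :
    ({i : Fin n // i ∉ S} → Fin d) × ({i : Fin n // i ∈ S} → Fin d) :=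
  (fun i => x i, fun i => x i)

/-- For `j ∈ S`, the basis label on all qudits other than `j` that is `p.1` outside `S` and `p.2`
on `S \ {j}`. -/
def glueLabel {d n : ℕ} (S : Finset (Fin n)) (j : Fin n)
    (p : ({i : Fin n // i ∉ S} → Fin d) × ({i : Fin n // i ∈ S ∧ i ≠ j} → Fin d)) :
    {i : Fin n // i ≠ j} → Fin d :=
  fun i => if h : i.1 ∈ S then p.2 ⟨i.1, h, i.2⟩ else p.1 ⟨i.1, h⟩

/-- A map `Φ` that takes operators on the qudits of `S \ {j}` to operators on the qudits of `S`,
applied to an operator on all qudits but `j`, with the identity on the qudits outside `S`. The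
result is an operator on all `n` qudits. -/
noncomputable def applyLocally {d n : ℕ} (S : Finset (Fin n)) (j : Fin n)
    (Φ : Matrix ({i : Fin n // i ∈ S ∧ i ≠ j} → Fin d) ({i : Fin n // i ∈ S ∧ i ≠ j} → Fin d) ℂ
      →ₗ[ℂ] Matrix ({i : Fin n // i ∈ S} → Fin d) ({i : Fin n // i ∈ S} → Fin d) ℂ)
    (σ : Matrix ({i : Fin n // i ≠ j} → Fin d) ({i : Fin n // i ≠ j} → Fin d) ℂ) :
    Matrix (Fin n → Fin d) (Fin n → Fin d) ℂ :=
  (ampliation Φ (σ.submatrix (glueLabel S j) (glueLabel S j))).submatrix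
    (splitLabel S) (splitLabel S)

/-- Some quantum channel that is supported on the qudits of `S` restores every code state of `C`
after qudit `j` has been erased. -/
def RecoversFrom {d n : ℕ} (C : Submodule ℂ (QuditSpace d n)) (S : Finset (Fin n))
    (j : Fin n) : Prop :=
  ∃ Φ : Matrix ({i : Fin n // i ∈ S ∧ i ≠ j} → Fin d) ({i : Fin n // i ∈ S ∧ i ≠ j} → Fin d) ℂ
      →ₗ[ℂ] Matrix ({i : Fin n // i ∈ S} → Fin d) ({i : Fin n // i ∈ S} → Fin d) ℂ,
    IsQuantumChannel Φ ∧
      ∀ ψ ∈ C, ‖ψ‖ = 1 → applyLocally S j Φ (traceOut j (ketBra ψ)) = ketBra ψ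

/-- `(r,t,s)`-quantum locally recoverable codes: every qudit `j` has `t` recovery sets `Γ l j`. -/
def IsQLRC {d n : ℕ} (r t s : ℕ) (C : Submodule ℂ (QuditSpace d n)) : Prop :=
  ∃ Γ : Fin t → Fin n → Finset (Fin n),
    (∀ l j, j ∈ Γ l j ∧ (Γ l j).card ≤ r + 1) ∧
    (∀ l j, RecoversFrom C (Γ l j) j) ∧
    (∀ j l₁ l₂, l₁ ≠ l₂ → (Γ l₁ j ∩ Γ l₂ j).card ≤ s + 1)

/-- An `[n,k]` quantum code of local dimension `d` encodes `k` logical qudits into `n` physical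
qudits: it is a subspace of `(ℂ^d)^{⊗ n}` of dimension `d ^ k`. -/
def Encodes {d n : ℕ} (C : Submodule ℂ (QuditSpace d n)) (k : ℕ) : Prop :=
  Module.finrank ℂ C = d ^ k

/-- `x = min {L, ⌊r / s⌋ + 1}`, where `r / 0` is read as infinity. -/
def xParam (r L s : ℕ) : ℕ := if s = 0 then L else min L (r / s + 1)

/-- Lower bound on the size of a union of `L` recovery sets of full size `r + 1`. -/
noncomputable def lowerN (r L s : ℕ) : ℝ :=
  (2 * (r : ℝ) - ((xParam r L s : ℝ) - 1) * (s : ℝ)) / 2 * (xParam r L s : ℝ) + 1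

/-- Upper bound on the size of a union of `L` recovery sets. -/
noncomputable def upperN (r L _s : ℕ) : ℝ := (L : ℝ) * (r : ℝ) + 1

/-- The number `p₂(r,t,s)`. -/
noncomputable def p2 (r t s : ℕ) : ℝ :=
  (∑ L ∈ (Finset.Icc 1 t).filter (fun L => L % 2 = 1), (t.choose L : ℝ) * (1 / upperN r L s)) -
    ∑ L ∈ (Finset.Icc 1 t).filter (fun L => L % 2 = 0), (t.choose L : ℝ) * (1 / lowerN r L s)

end QLRC

/-! Two disjoint correctable erasures `A`, `B` force `k ≤ n - |A| - |B|` (quantum Singleton bound),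
so it suffices to find large ones.

Recovery of `j` from `S \ {j}` makes `j` independent of everything outside `S`
(`RecoversFrom.exists_decoupling`). Hence, in any ordering of the qudits, those that come last in
one of their recovery sets form a correctable erasure (`correctable_of_recoversFrom_preceding`).

In a uniformly random ordering, a qudit is last in all `Γ l`, `l ∈ T`, with probability `1 / |⋃ Γ
l|`. Inclusion–exclusion, with the upper bound on the union for odd `|T|` and the lower bound for
even `|T|`, shows that it is last in some `Γ l` with probability at least `p2`. Thus every set `W`
of qudits contains a correctable subset of size `⌈|W| p2⌉` when `p2 > 0`. Taking `W` to be all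
qudits gives `A`, and taking `W = Aᶜ` gives `B`.

The Singleton bound is proved with ranks of reduced states in place of entropies. -/

namespace QLRC

/-! ### Kraus operators and decoupling -/

/-- The Kraus decomposition of a quantum channel. -/
theorem IsQuantumChannel.exists_kraus {α β : Type*} [Fintype α] [Fintype β] [DecidableEq α]
    {Φ : Matrix α α ℂ →ₗ[ℂ] Matrix β β ℂ} (hΦ : IsQuantumChannel Φ) :
    ∃ (N : ℕ) (K : Fin N → Matrix β α ℂ), (∀ X, Φ X = ∑ f, K f * X * (K f)ᴴ) ∧
      ∑ f, (K f)ᴴ * K f = 1 := by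
  let e := Fintype.equivFin α
  -- The unnormalised maximally entangled vector: its image under `id ⊗ Φ` is the Choi matrix, whose
  -- rank-one terms are the Kraus operators.
  let w : Fin (Fintype.card α) × α → ℂ := fun p => if e.symm p.1 = p.2 then 1 else 0
  have hJ := hΦ.completelyPositive _ _ (Matrix.posSemidef_vecMulVec_self_star w)
  obtain ⟨N, v, hv⟩ := Matrix.posSemidef_iff_eq_sum_vecMulVec.1 hJ
  let K : Fin N → Matrix β α ℂ := fun f => Matrix.of fun b a => v f (e a, b)
  have hsingle (a a' : α) (b b' : β) :
      Φ (Matrix.single a a' 1) b b' = ∑ f, K f b a * star (K f b' a') := by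
    have h := congrFun (congrFun hv (e a, b)) (e a', b')
    have hM : (Matrix.of fun x y => Matrix.vecMulVec w (star w) (e a, x) (e a', y)) =
        Matrix.single a a' 1 := by
      ext x y
      simp [Matrix.vecMulVec_apply, w, Matrix.single_apply, ← ite_and, and_comm]
    rw [ampliation, Matrix.of_apply, hM] at h
    simpa [Matrix.sum_apply, Matrix.vecMulVec_apply, K] using h
  have hK (X : Matrix α α ℂ) : Φ X = ∑ f, K f * X * (K f)ᴴ := by
    ext b b'
    have hX : X = ∑ a, ∑ a', X a a' • Matrix.single a a' (1 : ℂ) := by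
      simpa [Matrix.smul_single] using Matrix.matrix_eq_sum_single X
    conv_lhs => rw [hX]
    simp only [map_sum, map_smul, Matrix.sum_apply, Matrix.smul_apply, hsingle, smul_eq_mul,
      Matrix.mul_apply, Matrix.conjTranspose_apply, Finset.sum_mul, Finset.mul_sum]
    rw [Finset.sum_comm' (t' := Finset.univ) (s' := fun _ => Finset.univ) (by simp)]
    simp_rw [fun a' : α => Finset.sum_comm (s := (Finset.univ : Finset α))
      (t := (Finset.univ : Finset (Fin N)))
      (f := fun a f => X a a' * (K f b a * star (K f b' a')))]
    rw [Finset.sum_comm]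
    refine Finset.sum_congr rfl fun f _ => Finset.sum_congr rfl fun a' _ =>
      Finset.sum_congr rfl fun a _ => by ring
  refine ⟨N, K, hK, Matrix.ext_iff_trace_mul_right.2 fun X => ?_⟩
  rw [one_mul, ← hΦ.tracePreserving X, hK, Matrix.trace_sum, Finset.sum_mul, Matrix.trace_sum]
  refine Finset.sum_congr rfl fun f _ => ?_
  rw [Matrix.trace_mul_comm (K f * X), Matrix.mul_assoc]

theorem sum_piEquivPiSubtypeProd_fst {ι κ R : Type*} [Fintype ι] [DecidableEq ι] [Fintype κ]
    [CommSemiring R] (p : ι → Prop) [DecidablePred p] [Fintype ({i // p i} → κ)]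
    [Fintype ({i // ¬ p i} → κ)] (g : ({i // p i} → κ) → R) :
    ∑ z : ι → κ, g (fun i => z i) = Fintype.card ({i // ¬ p i} → κ) * ∑ w, g w := by
  rw [Fintype.sum_equiv (Equiv.piEquivPiSubtypeProd p fun _ => κ) (fun z => g fun i => z i)
    (fun q => g q.1) (fun _ => rfl), Fintype.sum_prod_type]
  simp [Finset.mul_sum]

/-- If the rank-one operators of finitely many vectors add up to that of `ψ`, then each of these
vectors is a multiple of `ψ`. -/
theorem exists_smul_of_sum_mul_star_eq {ι κ : Type*} [Fintype ι] [Fintype κ]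
    (v : κ → ι → ℂ) (ψ : ι → ℂ)
    (h : ∀ x y, ∑ f, v f x * star (v f y) = ψ x * star (ψ y)) (f : κ) :
    ∃ c : ℂ, v f = c • ψ := by
  by_cases hψ : ψ = 0
  · refine ⟨0, funext fun x => ?_⟩
    have hx := h x x
    simp only [hψ, Pi.zero_apply, zero_mul, Complex.star_def, Complex.mul_conj] at hx
    have hx' : ∑ f, Complex.normSq (v f x) = 0 := by exact_mod_cast hx
    have := (Finset.sum_eq_zero_iff_of_nonneg fun f _ => Complex.normSq_nonneg _).1 hx' f
      (Finset.mem_univ f)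
    simpa using this
  · let s : ℂ := star ψ ⬝ᵥ ψ
    have hs : s ≠ 0 := fun h0 => hψ (dotProduct_star_self_eq_zero.1 h0)
    refine ⟨(star ψ ⬝ᵥ v f) / s, ?_⟩
    -- the component of `v f` orthogonal to `ψ`
    let χ : ι → ℂ := v f - ((star ψ ⬝ᵥ v f) / s) • ψ
    have hψχ : star ψ ⬝ᵥ χ = 0 := by
      simp only [χ, dotProduct_sub, dotProduct_smul, smul_eq_mul]
      rw [div_mul_cancel₀ _ hs, sub_self]
    have hχψ : star χ ⬝ᵥ ψ = 0 := by
      have := congrArg star hψχ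
      rwa [Matrix.star_dotProduct, star_star, star_zero] at this
    -- Both sides of `h` are evaluated as quadratic forms at `χ`; the form of `ψ` vanishes there, so
    -- every nonnegative term does.
    have hsum : ∑ g, (star χ ⬝ᵥ v g) * star (star χ ⬝ᵥ v g) = 0 := by
      calc ∑ g, (star χ ⬝ᵥ v g) * star (star χ ⬝ᵥ v g)
          = ∑ x, ∑ y, star (χ x) * χ y * ∑ g, v g x * star (v g y) := by
            simp_rw [dotProduct, star_sum, Finset.sum_mul_sum]
            rw [Finset.sum_comm]
            refine Finset.sum_congr rfl fun x _ => ?_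
            rw [Finset.sum_comm]
            simp_rw [Finset.mul_sum]
            refine Finset.sum_congr rfl fun y _ => Finset.sum_congr rfl fun g _ => ?_
            simp only [Pi.star_apply, star_mul', star_star]
            ring
        _ = (star χ ⬝ᵥ ψ) * star (star χ ⬝ᵥ ψ) := by
            simp only [h, dotProduct, star_sum, Finset.sum_mul_sum]
            refine Finset.sum_congr rfl fun x _ => Finset.sum_congr rfl fun y _ => ?_
            simp only [Pi.star_apply, star_mul', star_star]
            ring
        _ = 0 := by rw [hχψ, zero_mul]
    have hf : star χ ⬝ᵥ v f = 0 := by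
      simp only [Complex.star_def, Complex.mul_conj] at hsum
      have hx' : ∑ g, Complex.normSq (star χ ⬝ᵥ v g) = 0 := by exact_mod_cast hsum
      simpa using (Finset.sum_eq_zero_iff_of_nonneg fun f _ => Complex.normSq_nonneg _).1 hx' f
        (Finset.mem_univ f)
    have hχ : star χ ⬝ᵥ χ = 0 := by
      have : star χ ⬝ᵥ χ = star χ ⬝ᵥ v f - ((star ψ ⬝ᵥ v f) / s) * (star χ ⬝ᵥ ψ) := by
        conv_lhs => rw [show χ = v f - ((star ψ ⬝ᵥ v f) / s) • ψ from rfl]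
        simp [dotProduct_sub, dotProduct_smul, χ]
      rw [this, hf, hχψ]; simp
    have : χ = 0 := dotProduct_star_self_eq_zero.1 hχ
    exact sub_eq_zero.1 this

/-- A linear map of which every vector of a subspace is an eigenvector acts on this subspace as
a scalar. -/
theorem exists_forall_apply_eq_smul {E : Type*} [AddCommGroup E] [Module ℂ E] (T : E →ₗ[ℂ] E)
    (C : Submodule ℂ E) (h : ∀ ψ ∈ C, ∃ c : ℂ, T ψ = c • ψ) :
    ∃ c : ℂ, ∀ ψ ∈ C, T ψ = c • ψ := by
  have hT : ∀ ψ ∈ C, T ψ ∈ C := fun ψ hψ => by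
    obtain ⟨c, hc⟩ := h ψ hψ
    exact hc ▸ C.smul_mem c hψ
  obtain ⟨c, hc⟩ := (T.restrict hT).exists_eq_smul_id_of_forall_notLinearIndependent fun v => by
    obtain ⟨c, hc⟩ := h v v.2
    rw [LinearIndependent.pair_iff]
    intro hv
    have := (hv c (-1) (by ext; simp [hc])).2
    norm_num at this
  exact ⟨c, fun ψ hψ => by simpa using congrArg Subtype.val (LinearMap.congr_fun hc ⟨ψ, hψ⟩)⟩

variable {d n : ℕ}

theorem insertAt_glueLabel_restrict {S : Finset (Fin n)} {j : Fin n} (hj : j ∈ S) (a : Fin d)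
    (z x : Fin n → Fin d) :
    insertAt j a (glueLabel S j (fun i => x i, fun i => z i)) =
      S.piecewise (Function.update z j a) x := by
  funext i
  by_cases hij : i = j
  · subst hij; simp [insertAt, hj]
  · by_cases hi : i ∈ S <;> simp [insertAt, glueLabel, hij, hi]

theorem splitLabel_piecewise (S : Finset (Fin n)) (z x : Fin n → Fin d) :
    splitLabel S (S.piecewise z x) =
      ((fun i => x i : {i : Fin n // i ∉ S} → Fin d),
        (fun i => z i : {i : Fin n // i ∈ S} → Fin d)) := by
  refine Prod.ext (funext fun i => ?_) (funext fun i => ?_)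
  · simp [splitLabel, i.2]
  · simp [splitLabel]

/-- The Kraus operator `k` on the qudits of `S \ {j}`, applied to `⟨a|ψ`, where `⟨a|` is a basis
bra of qudit `j`. -/
noncomputable def krausAt (S : Finset (Fin n)) (j : Fin n) (a : Fin d)
    (k : Matrix ({i : Fin n // i ∈ S} → Fin d) ({i : Fin n // i ∈ S ∧ i ≠ j} → Fin d) ℂ) :
    QuditSpace d n →ₗ[ℂ] QuditSpace d n where
  toFun ψ := WithLp.toLp 2 fun x =>
    ∑ u, k (splitLabel S x).2 u * ψ (insertAt j a (glueLabel S j ((splitLabel S x).1, u)))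
  map_add' ψ φ := by
    ext x; simp [mul_add, Finset.sum_add_distrib]
  map_smul' c ψ := by
    ext x; simp [Finset.mul_sum, mul_left_comm]

theorem krausAt_apply (S : Finset (Fin n)) (j : Fin n) (a : Fin d)
    (k : Matrix ({i : Fin n // i ∈ S} → Fin d) ({i : Fin n // i ∈ S ∧ i ≠ j} → Fin d) ℂ)
    (ψ : QuditSpace d n) (x : Fin n → Fin d) :
    krausAt S j a k ψ x =
      ∑ u, k (splitLabel S x).2 u * ψ (insertAt j a (glueLabel S j ((splitLabel S x).1, u))) :=
  rfl

/-- Erasure followed by recovery has Kraus operators `K f ⟨a|`, indexed by pairs `(a, f)`. -/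
theorem applyLocally_traceOut_ketBra {N : ℕ} (S : Finset (Fin n)) (j : Fin n)
    (Φ : Matrix ({i : Fin n // i ∈ S ∧ i ≠ j} → Fin d) ({i : Fin n // i ∈ S ∧ i ≠ j} → Fin d) ℂ
      →ₗ[ℂ] Matrix ({i : Fin n // i ∈ S} → Fin d) ({i : Fin n // i ∈ S} → Fin d) ℂ)
    (K : Fin N →
      Matrix ({i : Fin n // i ∈ S} → Fin d) ({i : Fin n // i ∈ S ∧ i ≠ j} → Fin d) ℂ)
    (hK : ∀ X, Φ X = ∑ f, K f * X * (K f)ᴴ) (ψ : QuditSpace d n) (x y : Fin n → Fin d) :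
    applyLocally S j Φ (traceOut j (ketBra ψ)) x y =
      ∑ q : Fin d × Fin N, krausAt S j q.1 (K q.2) ψ x * star (krausAt S j q.1 (K q.2) ψ y) := by
  simp only [applyLocally, ampliation, Matrix.submatrix_apply, Matrix.of_apply, hK,
    Matrix.sum_apply, Matrix.mul_apply, Matrix.conjTranspose_apply, traceOut, ketBra]
  rw [Fintype.sum_prod_type_right]
  refine Finset.sum_congr rfl fun f _ => ?_
  simp only [krausAt_apply, star_sum, Finset.mul_sum, Finset.sum_mul]
  rw [Finset.sum_comm (s := (Finset.univ : Finset (Fin d)))]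
  refine Finset.sum_congr rfl fun u _ => ?_
  rw [Finset.sum_comm (s := (Finset.univ : Finset (Fin d)))]
  refine Finset.sum_congr rfl fun v _ => Finset.sum_congr rfl fun a _ => ?_
  simp only [star_mul']
  ring

/-- Local recoverability of qudit `j` from `S \ {j}` decouples qudit `j` from the qudits
outside `S`. -/
theorem RecoversFrom.exists_decoupling {C : Submodule ℂ (QuditSpace d n)} {S : Finset (Fin n)}
    {j : Fin n} (hj : j ∈ S) (h : RecoversFrom C S j) :
    ∃ μ : Fin d → Fin d → ℂ, ∀ ψ ∈ C, ∀ φ ∈ C, ∀ (a b : Fin d) (x y : Fin n → Fin d),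
      ∑ z, ψ (S.piecewise (Function.update z j a) x) *
          star (φ (S.piecewise (Function.update z j b) y)) =
        μ a b * ∑ z, ψ (S.piecewise z x) * star (φ (S.piecewise z y)) := by
  obtain ⟨Φ, hΦ, hrec⟩ := h
  obtain ⟨N, K, hK, hK1⟩ := hΦ.exists_kraus
  have hsum (ψ : QuditSpace d n) (hψ : ψ ∈ C) (x y : Fin n → Fin d) :
      ∑ q : Fin d × Fin N, krausAt S j q.1 (K q.2) ψ x * star (krausAt S j q.1 (K q.2) ψ y) =
        ψ x * star (ψ y) := by
    rcases eq_or_ne ψ 0 with rfl | hψ0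
    · simp
    have hr : (‖ψ‖ : ℂ) ≠ 0 := by simpa using hψ0
    obtain ⟨χ, hχ, hχ1, hψχ⟩ : ∃ χ ∈ C, ‖χ‖ = 1 ∧ ψ = (‖ψ‖ : ℂ) • χ :=
      ⟨(‖ψ‖ : ℂ)⁻¹ • ψ, C.smul_mem _ hψ, by
        simp [norm_smul, inv_mul_cancel₀ (norm_ne_zero_iff.2 hψ0)], by
        rw [smul_smul, mul_inv_cancel₀ hr, one_smul]⟩
    have := congrFun (congrFun (hrec χ hχ hχ1) x) y
    rw [applyLocally_traceOut_ketBra S j Φ K hK, ketBra, Matrix.of_apply] at this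
    rw [hψχ]
    simp only [map_smul, PiLp.smul_apply, smul_eq_mul, star_mul'] at this ⊢
    rw [mul_mul_mul_comm, ← this, Finset.mul_sum]
    exact Finset.sum_congr rfl fun q _ => by ring
  -- Since the output is pure, each Kraus operator multiplies each code vector by a number, and by
  -- linearity this number is the same on all of `C`.
  have hc (q : Fin d × Fin N) : ∃ c : ℂ, ∀ ψ ∈ C, krausAt S j q.1 (K q.2) ψ = c • ψ :=
    exists_forall_apply_eq_smul _ C fun ψ hψ => by
      obtain ⟨c, hc⟩ := exists_smul_of_sum_mul_star_eq
        (fun (q : Fin d × Fin N) x => krausAt S j q.1 (K q.2) ψ x) (fun x => ψ x) (hsum ψ hψ) q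
      exact ⟨c, by ext x; exact congrFun hc x⟩
  choose c hc using hc
  -- In a sum over all labels, each label of `S` occurs `c₁` times and each label of `S \ {j}`
  -- occurs `c₂` times.
  let c₁ : ℂ := Fintype.card ({i : Fin n // ¬ i ∈ S} → Fin d)
  let c₂ : ℂ := Fintype.card ({i : Fin n // ¬ (i ∈ S ∧ i ≠ j)} → Fin d)
  refine ⟨fun a b => c₂ / c₁ * ∑ f, c (a, f) * star (c (b, f)), ?_⟩
  intro ψ hψ φ hφ a b x y
  have hc₁ : c₁ ≠ 0 := by
    have : Nonempty (Fin d) := ⟨a⟩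
    simp only [c₁]
    exact_mod_cast Fintype.card_ne_zero
  have hK1' (u u' : {i : Fin n // i ∈ S ∧ i ≠ j} → Fin d) :
      ∑ f, ∑ w, K f w u * star (K f w u') = if u = u' then 1 else 0 := by
    have := congrFun (congrFun hK1 u') u
    simp only [Matrix.sum_apply, Matrix.mul_apply, Matrix.conjTranspose_apply,
      Matrix.one_apply] at this
    rw [← (by simp [eq_comm] : (if u' = u then (1 : ℂ) else 0) = if u = u' then 1 else 0), ← this]
    exact Finset.sum_congr rfl fun f _ => Finset.sum_congr rfl fun w _ => mul_comm _ _
  let P : ({i : Fin n // i ∈ S ∧ i ≠ j} → Fin d) → ℂ := fun u =>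
    ψ (insertAt j a (glueLabel S j (fun i => x i, u)))
  let Q : ({i : Fin n // i ∈ S ∧ i ≠ j} → Fin d) → ℂ := fun u =>
    star (φ (insertAt j b (glueLabel S j (fun i => y i, u))))
  have hleft : ∑ z, ψ (S.piecewise (Function.update z j a) x) *
      star (φ (S.piecewise (Function.update z j b) y)) = c₂ * ∑ u, P u * Q u := by
    rw [← sum_piEquivPiSubtypeProd_fst (fun i => i ∈ S ∧ i ≠ j) (fun u => P u * Q u)]
    exact Finset.sum_congr rfl fun z _ => by
      simp only [P, Q, insertAt_glueLabel_restrict hj]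
  have hright : ∑ f, ∑ z, krausAt S j a (K f) ψ (S.piecewise z x) *
      star (krausAt S j b (K f) φ (S.piecewise z y)) = c₁ * ∑ u, P u * Q u := by
    have (f : Fin N) : ∑ z, krausAt S j a (K f) ψ (S.piecewise z x) *
        star (krausAt S j b (K f) φ (S.piecewise z y)) =
        c₁ * ∑ w, ∑ u, ∑ u', K f w u * star (K f w u') * (P u * Q u') := by
      refine Eq.trans ?_ (sum_piEquivPiSubtypeProd_fst (fun i => i ∈ S)
        (fun w => ∑ u, ∑ u', K f w u * star (K f w u') * (P u * Q u')))
      refine Finset.sum_congr rfl fun z _ => ?_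
      simp only [krausAt_apply, splitLabel_piecewise, star_sum, Finset.sum_mul_sum, star_mul', P, Q]
      exact Finset.sum_congr rfl fun u _ => Finset.sum_congr rfl fun u' _ => by ring
    simp only [this]
    rw [← Finset.mul_sum]
    congr 1
    calc _ = ∑ u, ∑ u', (∑ f, ∑ w, K f w u * star (K f w u')) * (P u * Q u') := by
          simp only [Finset.sum_mul]
          rw [← Fintype.sum_prod_type', Finset.sum_comm]
          refine Finset.sum_congr rfl fun u _ => ?_
          rw [Finset.sum_comm]
          exact Finset.sum_congr rfl fun u' _ => Fintype.sum_prod_type _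
      _ = _ := by simp only [hK1', ite_mul, one_mul, zero_mul, Finset.sum_ite_eq, Finset.mem_univ,
        if_true]
  have hcc : ∑ f, ∑ z, krausAt S j a (K f) ψ (S.piecewise z x) *
      star (krausAt S j b (K f) φ (S.piecewise z y)) =
      (∑ f, c (a, f) * star (c (b, f))) * ∑ z, ψ (S.piecewise z x) * star (φ (S.piecewise z y)) := by
    rw [Finset.sum_mul_sum]
    refine Finset.sum_congr rfl fun f _ => Finset.sum_congr rfl fun z _ => ?_
    rw [hc (a, f) ψ hψ, hc (b, f) φ hφ]
    simp only [PiLp.smul_apply, smul_eq_mul, star_mul']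
    ring
  rw [hleft, mul_assoc, ← hcc, hright]
  field_simp

end QLRC

/-! ### Rank factorisation and block-diagonal matrices -/

theorem Matrix.exists_eq_mul_of_rank {m n K : Type*} [Fintype m] [Fintype n] [Field K]
    (A : Matrix m n K) :
    ∃ (P : Matrix m (Fin A.rank) K) (Q : Matrix (Fin A.rank) n K), A = P * Q := by
  classical
  let b := Module.finBasis K (LinearMap.range A.mulVecLin)
  have hmem (y : n) : A.col y ∈ LinearMap.range A.mulVecLin := ⟨Pi.single y 1, by simp⟩
  refine ⟨Matrix.of fun x i => (b i : m → K) x, Matrix.of fun i y => b.repr ⟨_, hmem y⟩ i, ?_⟩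
  ext x y
  have h := congrFun (congrArg Subtype.val (b.sum_repr ⟨_, hmem y⟩)) x
  simp only [Submodule.coe_sum, Submodule.coe_smul, Finset.sum_apply, Pi.smul_apply,
    smul_eq_mul] at h
  rw [Matrix.mul_apply]
  exact h.symm.trans (Finset.sum_congr rfl fun i _ => mul_comm _ _)

/-- Independent columns of `A`, repeated in every diagonal block, stay independent. -/
theorem Matrix.card_mul_rank_le_rank_of_blocks {ι m K : Type*} [Fintype ι] [DecidableEq ι]
    [Fintype m] [Field K] (A : Matrix m m K) (G : Matrix (ι × m) (ι × m) K)
    (hG : ∀ p q, G p q = if p.1 = q.1 then A p.2 q.2 else 0) :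
    Fintype.card ι * A.rank ≤ G.rank := by
  classical
  obtain ⟨κ, c, hc, hspan, hli⟩ := exists_linearIndependent' K A.col
  have : Fintype κ := Fintype.ofInjective c hc
  have hκ : Fintype.card κ = A.rank := by
    rw [Matrix.rank_eq_finrank_span_cols, ← hspan, finrank_span_eq_card hli]
  have hli' : LinearIndependent K fun p : ι × κ => G.col (p.1, c p.2) := by
    rw [Fintype.linearIndependent_iff] at hli ⊢
    intro g hg p
    refine hli (fun y => g (p.1, y)) (funext fun x => ?_) p.2
    have h := congrFun hg (p.1, x)
    simp only [Finset.sum_apply, Pi.smul_apply, smul_eq_mul, Fintype.sum_prod_type,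
      Matrix.col_apply, hG, Pi.zero_apply] at h
    rw [Finset.sum_eq_single p.1 (fun i _ hi => by simp [hi.symm]) (by simp)] at h
    simpa using h
  rw [← hκ, ← Fintype.card_prod, ← finrank_span_eq_card hli', Matrix.rank_eq_finrank_span_cols]
  refine Submodule.finrank_mono (Submodule.span_mono ?_)
  rintro _ ⟨p, rfl⟩
  exact ⟨_, rfl⟩

namespace QLRC

variable {d n : ℕ}

/-! ### Correctable erasures -/

/-- The Knill–Laflamme condition for the erasure of the qudits of `U`: the reduced operator
`Tr_{Uᶜ} |ψ⟩⟨φ|` is a multiple of `⟨φ, ψ⟩` that does not depend on the vectors `ψ, φ` of the code.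
The sum over the labels of `Uᶜ` is replaced by that over all labels, which counts each label of
`Uᶜ` equally often. -/
def Correctable (C : Submodule ℂ (QuditSpace d n)) (U : Finset (Fin n)) : Prop :=
  ∃ μ : (Fin n → Fin d) → (Fin n → Fin d) → ℂ, ∀ ψ ∈ C, ∀ φ ∈ C, ∀ a b : Fin n → Fin d,
    ∑ z, ψ (U.piecewise a z) * star (φ (U.piecewise b z)) = μ a b * ∑ z, ψ z * star (φ z)

theorem correctable_empty (C : Submodule ℂ (QuditSpace d n)) : Correctable C ∅ :=
  ⟨fun _ _ => 1, by simp⟩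

/-- Exchanging the `S`-parts of `z` and `w` is an involution on pairs of labels. -/
theorem sum_sum_piecewise {ι κ R : Type*} [Fintype ι] [DecidableEq ι] [Fintype κ] [CommSemiring R]
    (S : Finset ι) (f : (ι → κ) → R) :
    ∑ z, ∑ w, f (S.piecewise w z) = Fintype.card (ι → κ) * ∑ z, f z := by
  let e : (ι → κ) × (ι → κ) → (ι → κ) × (ι → κ) :=
    fun p => (S.piecewise p.2 p.1, S.piecewise p.1 p.2)
  have he : Function.Involutive e := fun p => by
    refine Prod.ext (funext fun i => ?_) (funext fun i => ?_) <;>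
      by_cases hi : i ∈ S <;> simp [e, hi]
  rw [← Fintype.sum_prod_type', Fintype.sum_equiv he.toPerm
    (fun p => f (S.piecewise p.2 p.1)) (fun p => f p.1) (fun p => rfl),
    Fintype.sum_prod_type]
  simp [Finset.mul_sum]

/-- As `U` misses `S`, decoupling can be applied with the labels of `U` held fixed: it replaces the
fixed label of `j` by a trace over all of `S`, at the cost of a factor `ν`. What remains is the
condition for `U`. -/
theorem Correctable.insert_of_recoversFrom {C : Submodule ℂ (QuditSpace d n)}
    {U S : Finset (Fin n)} {j : Fin n}
    (hU : Correctable C U) (hj : j ∈ S) (hS : RecoversFrom C S j) (hUS : Disjoint U S) :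
    Correctable C (insert j U) := by
  obtain ⟨μ, hμ⟩ := hU
  obtain ⟨ν, hν⟩ := hS.exists_decoupling hj
  refine ⟨fun a b => ν (a j) (b j) * μ a b, fun ψ hψ φ hφ a b => ?_⟩
  have hcard : (Fintype.card (Fin n → Fin d) : ℂ) ≠ 0 := by
    have : Nonempty (Fin n → Fin d) := ⟨a⟩
    exact_mod_cast Fintype.card_ne_zero
  have h₁ (a z w : Fin n → Fin d) : (insert j U).piecewise a (S.piecewise w z) =
      S.piecewise (Function.update w j (a j)) (U.piecewise a z) := by
    funext i
    by_cases hij : i = j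
    · subst hij; simp [hj]
    by_cases hiS : i ∈ S
    · simp [Finset.piecewise, hij, hiS, Finset.disjoint_right.1 hUS hiS]
    · simp [Finset.piecewise, hij, hiS]
  have h₂ (a z w : Fin n → Fin d) : S.piecewise w (U.piecewise a z) =
      U.piecewise a (S.piecewise w z) := by
    funext i
    by_cases hiS : i ∈ S
    · simp [Finset.piecewise, hiS, Finset.disjoint_right.1 hUS hiS]
    · simp [Finset.piecewise, hiS]
  refine mul_left_cancel₀ hcard ?_
  rw [← sum_sum_piecewise S
    (fun z => ψ ((insert j U).piecewise a z) * star (φ ((insert j U).piecewise b z)))]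
  simp only [h₁, hν ψ hψ φ hφ]
  rw [← Finset.mul_sum, mul_assoc, ← hμ ψ hψ φ hφ, mul_left_comm,
    ← sum_sum_piecewise S (fun z => ψ (U.piecewise a z) * star (φ (U.piecewise b z)))]
  simp only [h₂]

/-- If every qudit of `U` is recoverable from qudits that precede it, then the erasure of `U` is
correctable. -/
theorem correctable_of_recoversFrom_preceding {α : Type*} [LinearOrder α]
    {C : Submodule ℂ (QuditSpace d n)} (f : Fin n → α) (hf : Function.Injective f)
    (U : Finset (Fin n))
    (hU : ∀ j ∈ U, ∃ S : Finset (Fin n), j ∈ S ∧ RecoversFrom C S j ∧ ∀ i ∈ S, f i ≤ f j) :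
    Correctable C U := by
  -- The inserted `j` precedes all of `U`, so its recovery set, which does not go beyond `j`, misses
  -- `U`.
  induction U using Finset.induction_on_min_value f with
  | empty => exact correctable_empty C
  | insert j U hjU hmin ih =>
    obtain ⟨S, hjS, hS, hle⟩ := hU j (Finset.mem_insert_self _ _)
    refine (ih fun i hi => hU i (Finset.mem_insert_of_mem hi)).insert_of_recoversFrom hjS hS ?_
    rw [Finset.disjoint_left]
    intro i hi hiS
    exact hjU (hf (le_antisymm (hle i hiS) (hmin i hi)) ▸ hi)

/-! ### The quantum Singleton bound by ranks -/

variable {K : ℕ}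

/-- The matrix of the code vectors `ψ i` cut between the reference and `U` on one side, and the
complement of `U` on the other side. -/
def codeCut (ψ : Fin K → QuditSpace d n) (U : Finset (Fin n)) :
    Matrix (Fin K × (Fin n → Fin d)) (Fin n → Fin d) ℂ :=
  Matrix.of fun p z => ψ p.1 (U.piecewise p.2 z)

/-- The matrix of the code vectors `ψ i` cut between `U` on one side, and the reference and the
complement of `U` on the other side. -/
def erasureCut (ψ : Fin K → QuditSpace d n) (U : Finset (Fin n)) :
    Matrix (Fin n → Fin d) (Fin K × (Fin n → Fin d)) ℂ :=
  Matrix.of fun a q => ψ q.1 (U.piecewise a q.2)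

/-- Correctability makes the reference and `U` uncorrelated. Multiplied by its adjoint, `codeCut`
gives `K` diagonal blocks `μ` and `erasureCut` gives `K • μ`; these products keep the rank. -/
theorem mul_rank_erasureCut_le {C : Submodule ℂ (QuditSpace d n)} {U : Finset (Fin n)}
    (hU : Correctable C U) (ψ : Fin K → QuditSpace d n) (hψC : ∀ i, ψ i ∈ C)
    (hψ : Orthonormal ℂ ψ) :
    K * (erasureCut ψ U).rank ≤ (codeCut ψ U).rank := by
  rcases Nat.eq_zero_or_pos K with rfl | hK
  · simp
  obtain ⟨μ, hμ⟩ := hU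
  have hinner (i j : Fin K) : ∑ z, ψ i z * star (ψ j z) = if i = j then 1 else 0 := by
    have := (orthonormal_iff_ite.1 hψ) j i
    rw [PiLp.inner_apply] at this
    simpa [eq_comm, mul_comm] using this
  have hcode : codeCut ψ U * (codeCut ψ U)ᴴ =
      Matrix.of fun p q => if p.1 = q.1 then Matrix.of μ p.2 q.2 else 0 := by
    ext p q
    simp only [Matrix.mul_apply, Matrix.conjTranspose_apply, codeCut, Matrix.of_apply,
      hμ _ (hψC p.1) _ (hψC q.1), hinner, mul_ite, mul_one, mul_zero]
  have herasure : erasureCut ψ U * (erasureCut ψ U)ᴴ = (K : ℂ) • Matrix.of μ := by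
    ext a b
    simp only [Matrix.mul_apply, Matrix.conjTranspose_apply, erasureCut, Matrix.of_apply,
      Fintype.sum_prod_type, hμ _ (hψC _) _ (hψC _), hinner]
    simp
  have hrank : (erasureCut ψ U).rank = (Matrix.of μ).rank := by
    rw [← Matrix.rank_self_mul_conjTranspose, herasure]
    exact Matrix.rank_smul_of_mem_nonZeroDivisors _
      (mem_nonZeroDivisors_of_ne_zero (by exact_mod_cast hK.ne'))
  rw [hrank, ← Matrix.rank_self_mul_conjTranspose (codeCut ψ U), hcode]
  have := Matrix.card_mul_rank_le_rank_of_blocks (ι := Fin K) (Matrix.of μ)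
    (Matrix.of fun p q => if p.1 = q.1 then Matrix.of μ p.2 q.2 else 0) fun p q => rfl
  rwa [Fintype.card_fin] at this

/-- Off `A`, a label consists of its part on `B` and its part on the remaining qudits, so a rank
factorisation of the cut at `B` factors `codeCut ψ A` through `rank × d ^ |rest|` dimensions. -/
theorem rank_codeCut_le (ψ : Fin K → QuditSpace d n) {A B : Finset (Fin n)}
    (hAB : Disjoint A B) :
    (codeCut ψ A).rank ≤ (erasureCut ψ B).rank * d ^ (A ∪ B)ᶜ.card := by
  classical
  rcases isEmpty_or_nonempty (Fin n → Fin d) with hX | ⟨⟨x₀⟩⟩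
  · exact (Matrix.rank_le_card_width _).trans (by simp)
  obtain ⟨P, Q, hPQ⟩ := (erasureCut ψ B).exists_eq_mul_of_rank
  let D := {i : Fin n // i ∈ (A ∪ B)ᶜ} → Fin d
  let ext : D → Fin n → Fin d := fun c i => if h : i ∈ (A ∪ B)ᶜ then c ⟨i, h⟩ else x₀ i
  let L : Matrix (Fin K × (Fin n → Fin d)) (Fin (erasureCut ψ B).rank × D) ℂ :=
    Matrix.of fun p q => Q q.1 (p.1, A.piecewise p.2 (ext q.2))
  let R : Matrix (Fin (erasureCut ψ B).rank × D) (Fin n → Fin d) ℂ :=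
    Matrix.of fun q z => if (fun i : {i : Fin n // i ∈ (A ∪ B)ᶜ} => z i) = q.2 then P z q.1 else 0
  have hLR : codeCut ψ A = L * R := by
    funext p z
    have hlabel : A.piecewise p.2 z =
        B.piecewise z (A.piecewise p.2 (ext fun i => z i)) := by
      funext i
      by_cases hA : i ∈ A
      · simp [Finset.piecewise, hA, Finset.disjoint_left.1 hAB hA]
      · by_cases hB : i ∈ B <;> simp [Finset.piecewise, hA, hB, ext]
    calc codeCut ψ A p z
        = erasureCut ψ B z (p.1, A.piecewise p.2 (ext fun i => z i)) := by
          simp only [codeCut, erasureCut, Matrix.of_apply, ← hlabel]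
      _ = (L * R) p z := by
          refine (congrFun (congrFun hPQ _) _).trans ?_
          rw [Matrix.mul_apply, Matrix.mul_apply, Fintype.sum_prod_type]
          refine Finset.sum_congr rfl fun m _ => ?_
          refine Eq.symm ((Finset.sum_eq_single (fun i => z i : D) ?_ ?_).trans ?_)
          · intro c _ hc
            simp [L, R, hc.symm]
          · simp
          · simp [L, R, mul_comm]
  rw [hLR]
  refine (Matrix.rank_mul_le_left _ _).trans ((Matrix.rank_le_card_width _).trans ?_)
  rw [Fintype.card_prod, Fintype.card_fin, Fintype.card_fun, Fintype.card_fin, Fintype.card_coe]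

/-- The quantum Singleton bound, for two disjoint correctable erasures. -/
theorem finrank_le_of_correctable {C : Submodule ℂ (QuditSpace d n)} {A B : Finset (Fin n)}
    (hA : Correctable C A) (hB : Correctable C B) (hAB : Disjoint A B) :
    Module.finrank ℂ C ≤ d ^ (A ∪ B)ᶜ.card := by
  rcases Nat.eq_zero_or_pos (Module.finrank ℂ C) with h0 | hK
  · simp [h0]
  let b := stdOrthonormalBasis ℂ C
  let ψ : Fin (Module.finrank ℂ C) → QuditSpace d n := fun i => b i
  have hψ : Orthonormal ℂ ψ := b.orthonormal.comp_linearIsometry C.subtypeₗᵢ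
  have hψC (i) : ψ i ∈ C := (b i).2
  have hpos (U : Finset (Fin n)) : 0 < (erasureCut ψ U).rank := by
    by_contra h
    obtain ⟨P, Q, hPQ⟩ := (erasureCut ψ U).exists_eq_mul_of_rank
    have : IsEmpty (Fin (erasureCut ψ U).rank) := by
      rw [Nat.eq_zero_of_not_pos h]; infer_instance
    refine hψ.ne_zero ⟨0, hK⟩ ?_
    ext x
    have h0 : erasureCut ψ U x (⟨0, hK⟩, x) = 0 :=
      (congrFun (congrFun hPQ x) _).trans (Matrix.mul_apply.trans (Fintype.sum_empty _))
    have hx : U.piecewise x x = x := funext fun i => by simp [Finset.piecewise]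
    rwa [erasureCut, Matrix.of_apply, hx] at h0
  have h₁ := (mul_rank_erasureCut_le hA ψ hψC hψ).trans (rank_codeCut_le ψ hAB)
  have h₂ := (mul_rank_erasureCut_le hB ψ hψC hψ).trans (rank_codeCut_le ψ hAB.symm)
  rw [Finset.union_comm] at h₂
  have hA := hpos A
  have hB := hpos B
  generalize (erasureCut ψ A).rank = x at *
  generalize (erasureCut ψ B).rank = y at *
  -- The inequality with the larger rank on its left is the one from which the ranks cancel.
  rcases le_total x y with h | h
  · refine Nat.le_of_mul_le_mul_right (h₂.trans ?_) hB
    rw [mul_comm]; gcongr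
  · refine Nat.le_of_mul_le_mul_right (h₁.trans ?_) hA
    rw [mul_comm]; gcongr

end QLRC

namespace QLRC

/-! ### Sizes of unions of recovery sets -/

section RecoverySetUnions

open Finset

variable {Ω : Type*} [DecidableEq Ω] {t r s : ℕ} {Γ : Fin t → Finset Ω} {a : Ω}

theorem card_biUnion_le_upperN (hΓ : ∀ l, a ∈ Γ l ∧ #(Γ l) = r + 1) (T : Finset (Fin t)) :
    (#(T.biUnion Γ) : ℝ) ≤ upperN r #T s := by
  have h : T.biUnion Γ ⊆ insert a (T.biUnion fun l => (Γ l).erase a) := by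
    intro x hx
    simp only [mem_biUnion, mem_insert, mem_erase] at hx ⊢
    obtain ⟨l, hl, hx⟩ := hx
    by_cases hxa : x = a
    · exact Or.inl hxa
    · exact Or.inr ⟨l, hl, hxa, hx⟩
  have h₁ : #(T.biUnion fun l => (Γ l).erase a) ≤ #T * r :=
    card_biUnion_le_card_mul _ _ _ fun l _ => by
      rw [card_erase_of_mem (hΓ l).1, (hΓ l).2]; simp
  have h₂ := (card_le_card h).trans ((card_insert_le _ _).trans (Nat.add_le_add_right h₁ 1))
  rw [upperN]
  exact_mod_cast h₂

/-- A set added to `m` others contributes at least `r - m * s` new elements. -/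
theorem le_card_biUnion (hΓ : ∀ l, #(Γ l) = r)
    (hs : ∀ l₁ l₂, l₁ ≠ l₂ → #(Γ l₁ ∩ Γ l₂) ≤ s) (T : Finset (Fin t)) :
    (2 * (r : ℝ) - ((#T : ℝ) - 1) * (s : ℝ)) / 2 * (#T : ℝ) ≤ #(T.biUnion Γ) := by
  induction T using Finset.induction_on with
  | empty => simp
  | insert l T hl ih =>
    have hinter : #(Γ l ∩ T.biUnion Γ) ≤ #T * s := by
      rw [inter_biUnion]
      exact card_biUnion_le_card_mul _ _ _ fun m hm => hs l m fun h => hl (h ▸ hm)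
    have hunion := card_union_add_card_inter (Γ l) (T.biUnion Γ)
    rw [hΓ l] at hunion
    rw [biUnion_insert, card_insert_of_notMem hl]
    have h₁ : (#(Γ l ∩ T.biUnion Γ) : ℝ) ≤ #T * s := by exact_mod_cast hinter
    have h₂ : (#(Γ l ∪ T.biUnion Γ) : ℝ) + #(Γ l ∩ T.biUnion Γ) = r + #(T.biUnion Γ) := by
      exact_mod_cast hunion
    push_cast
    linarith

theorem lowerN_le_card_biUnion (hΓ : ∀ l, a ∈ Γ l ∧ #(Γ l) = r + 1)
    (hs : ∀ l₁ l₂, l₁ ≠ l₂ → #(Γ l₁ ∩ Γ l₂) ≤ s + 1) {T : Finset (Fin t)} (hT : T.Nonempty) :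
    lowerN r #T s ≤ #(T.biUnion Γ) := by
  have hx : xParam r #T s ≤ #T := by
    rw [xParam]; split_ifs <;> simp
  -- The quadratic bound stops growing once `m * s > r`, so it is applied to a subfamily of size
  -- `xParam`; the common point `a` is set apart and gives the `+ 1`.
  obtain ⟨T', hT', hcard⟩ := exists_subset_card_eq hx
  have h := le_card_biUnion (r := r) (s := s) (Γ := fun l => (Γ l).erase a)
    (fun l => by rw [card_erase_of_mem (hΓ l).1, (hΓ l).2]; simp)
    (fun l₁ l₂ hl => by
      rw [erase_inter, inter_erase, erase_idem,
        card_erase_of_mem (mem_inter.2 ⟨(hΓ l₁).1, (hΓ l₂).1⟩)]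
      exact Nat.sub_le_iff_le_add.2 (hs l₁ l₂ hl)) T'
  have hsub : insert a (T'.biUnion fun l => (Γ l).erase a) ⊆ T.biUnion Γ := by
    intro x hx
    simp only [mem_biUnion, mem_insert, mem_erase] at hx ⊢
    rcases hx with rfl | ⟨l, hl, -, hx⟩
    · exact hT.imp fun l hl => ⟨hl, (hΓ l).1⟩
    · exact ⟨l, hT' hl, hx⟩
  have h' := card_le_card hsub
  rw [card_insert_of_notMem (by simp)] at h'
  have h'' : (#(T'.biUnion fun l => (Γ l).erase a) : ℝ) + 1 ≤ #(T.biUnion Γ) := by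
    exact_mod_cast h'
  rw [hcard] at h
  rw [lowerN]
  linarith

end RecoverySetUnions

/-! ### Random numberings and inclusion–exclusion -/

open Finset in
/-- The numberings of a finite type for which `a` comes last among the elements of `A`. -/
def numberingsLast {Ω : Type*} [Fintype Ω] [DecidableEq Ω] (A : Finset Ω) (a : Ω) :
    Finset (Ω ≃ Fin (Fintype.card Ω)) :=
  univ.filter fun σ => ∀ x ∈ A, σ x ≤ σ a

section Numberings

open Finset

variable {Ω : Type*} [Fintype Ω] [DecidableEq Ω]

theorem mem_numberingsLast {A : Finset Ω} {a : Ω} {σ : Ω ≃ Fin (Fintype.card Ω)} :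
    σ ∈ numberingsLast A a ↔ ∀ x ∈ A, σ x ≤ σ a := by
  simp [numberingsLast]

/-- Precomposition with the transposition of `a` and `b` is injective and makes `b` last instead of
`a`. -/
theorem card_numberingsLast_le {A : Finset Ω} {a b : Ω} (ha : a ∈ A) (hb : b ∈ A) :
    #(numberingsLast A a) ≤ #(numberingsLast A b) := by
  refine card_le_card_of_injOn (fun σ => (Equiv.swap a b).trans σ) ?_ ?_
  · intro σ hσ
    simp only [mem_coe, mem_numberingsLast] at hσ ⊢
    intro x hx
    simp only [Equiv.trans_apply, Equiv.swap_apply_right]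
    refine hσ _ ?_
    rcases eq_or_ne x a with rfl | hxa
    · simpa using hb
    rcases eq_or_ne x b with rfl | hxb
    · simpa using ha
    · rwa [Equiv.swap_apply_of_ne_of_ne hxa hxb]
  · intro σ _ τ _ h
    ext x
    have := congrArg (fun e : Ω ≃ Fin (Fintype.card Ω) => e (Equiv.swap a b x)) h
    simpa using congrArg Fin.val this

/-- Each numbering has exactly one last element in `A`, and all elements of `A` are equally often
last. -/
theorem card_mul_card_numberingsLast {A : Finset Ω} {a : Ω} (ha : a ∈ A) :
    #A * #(numberingsLast A a) = Fintype.card (Ω ≃ Fin (Fintype.card Ω)) := by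
  calc #A * #(numberingsLast A a) = ∑ b ∈ A, #(numberingsLast A b) := by
        rw [sum_congr rfl fun b hb =>
          le_antisymm (card_numberingsLast_le hb ha) (card_numberingsLast_le ha hb), sum_const,
          smul_eq_mul]
    _ = ∑ σ : Ω ≃ Fin (Fintype.card Ω), #(A.filter fun b => ∀ x ∈ A, σ x ≤ σ b) :=
        sum_card_bipartiteAbove_eq_sum_card_bipartiteBelow
          (fun b (σ : Ω ≃ Fin (Fintype.card Ω)) => ∀ x ∈ A, σ x ≤ σ b)
    _ = ∑ σ : Ω ≃ Fin (Fintype.card Ω), 1 := by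
        refine sum_congr rfl fun σ _ => ?_
        obtain ⟨b, hb, hmax⟩ := A.exists_max_image σ ⟨a, ha⟩
        refine card_eq_one.2 ⟨b, ?_⟩
        ext c
        simp only [mem_filter, mem_singleton]
        constructor
        · rintro ⟨hc, h⟩
          exact σ.injective (le_antisymm (hmax c hc) (h b hb))
        · rintro rfl
          exact ⟨hb, hmax⟩
    _ = _ := by simp

variable {t r s : ℕ} {Γ : Fin t → Finset Ω} {a : Ω}

theorem lowerN_pos (r L s : ℕ) : 0 < lowerN r L s := by
  have h : ((xParam r L s : ℝ) - 1) * s ≤ r := by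
    rw [xParam]
    split_ifs with hs
    · simp [hs]
    · have h₁ : (min L (r / s + 1) : ℕ) * s ≤ r + s := by
        calc _ ≤ (r / s + 1) * s := Nat.mul_le_mul_right _ (min_le_right _ _)
          _ ≤ r + s := by rw [add_mul, one_mul]; exact Nat.add_le_add_right (Nat.div_mul_le_self _ _) _
      have h₂ : ((min L (r / s + 1) : ℕ) : ℝ) * s ≤ r + s := by exact_mod_cast h₁
      linarith
  have hr : (0 : ℝ) ≤ r := Nat.cast_nonneg r
  have : 0 ≤ (2 * (r : ℝ) - ((xParam r L s : ℝ) - 1) * s) / 2 * (xParam r L s : ℝ) :=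
    mul_nonneg (by linarith) (Nat.cast_nonneg _)
  rw [lowerN]
  linarith

theorem p2_eq_sum_subsets (r t s : ℕ) :
    p2 r t s = ∑ T ∈ (univ : Finset (Fin t)).powerset.filter (·.Nonempty),
      if #T % 2 = 1 then 1 / upperN r #T s else -(1 / lowerN r #T s) := by
  -- The value `0` at `L = 0` lets the empty set join the sum.
  let g : ℕ → ℝ := fun L => if L = 0 then 0 else
    if L % 2 = 1 then 1 / upperN r L s else -(1 / lowerN r L s)
  have h₁ : ∑ T ∈ (univ : Finset (Fin t)).powerset.filter (·.Nonempty),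
      (if #T % 2 = 1 then 1 / upperN r #T s else -(1 / lowerN r #T s)) =
      ∑ T ∈ (univ : Finset (Fin t)).powerset, g #T := by
    rw [sum_filter]
    refine sum_congr rfl fun T _ => ?_
    by_cases hT : T = ∅ <;> simp [g, hT, nonempty_iff_ne_empty]
  rw [h₁, sum_powerset_apply_card, card_univ, Fintype.card_fin, p2, sum_filter, sum_filter,
    ← sum_sub_distrib, range_eq_Ico, sum_eq_sum_Ico_succ_bot (Nat.succ_pos t)]
  simp only [g, if_true, smul_zero, zero_add]
  refine sum_congr rfl fun L hL => ?_
  have hL0 : L ≠ 0 := by have := (mem_Icc.1 hL).1; omega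
  rcases Nat.mod_two_eq_zero_or_one L with h | h <;> simp [h, hL0]

/-- Being last in every `Γ l`, `l ∈ T`, means being last in their union, so each inclusion–exclusion
term is `± 1 / |⋃ Γ l|` of all numberings and is bounded according to its sign. -/
theorem p2_mul_le_card_biUnion (hΓ : ∀ l, a ∈ Γ l ∧ #(Γ l) = r + 1)
    (hs : ∀ l₁ l₂, l₁ ≠ l₂ → #(Γ l₁ ∩ Γ l₂) ≤ s + 1) :
    p2 r t s * Fintype.card (Ω ≃ Fin (Fintype.card Ω)) ≤
      #(univ.biUnion fun l => numberingsLast (Γ l) a) := by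
  have h := congrArg (Int.cast : ℤ → ℝ)
    (inclusion_exclusion_card_biUnion univ fun l => numberingsLast (Γ l) a)
  push_cast at h
  rw [h, p2_eq_sum_subsets, ← sum_coe_sort, sum_mul]
  refine sum_le_sum fun T _ => ?_
  have hT := (mem_filter.1 T.2).2
  have hinf : T.1.inf' hT (fun l => numberingsLast (Γ l) a) =
      numberingsLast (T.1.biUnion Γ) a := by
    ext σ
    rw [inf'_eq_inf, mem_inf]
    simp only [mem_numberingsLast, mem_biUnion]
    exact ⟨fun h x ⟨l, hl, hx⟩ => h l hl x hx, fun h l hl x hx => h x ⟨l, hl, hx⟩⟩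
  obtain ⟨l, hl⟩ := hT
  have ha : a ∈ T.1.biUnion Γ := mem_biUnion.2 ⟨l, hl, (hΓ l).1⟩
  have hcard : (#(T.1.biUnion Γ) : ℝ) * #(numberingsLast (T.1.biUnion Γ) a) =
      Fintype.card (Ω ≃ Fin (Fintype.card Ω)) := by
    exact_mod_cast card_mul_card_numberingsLast ha
  have hpos : (0 : ℝ) < #(T.1.biUnion Γ) := by exact_mod_cast card_pos.2 ⟨a, ha⟩
  rw [hinf, ← hcard]
  set u : ℝ := (#(T.1.biUnion Γ) : ℝ)
  set q : ℝ := (#(numberingsLast (T.1.biUnion Γ) a) : ℝ)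
  have hq : 0 ≤ q := Nat.cast_nonneg _
  rcases Nat.mod_two_eq_zero_or_one #T.1 with hpar | hpar
  · have hlow : lowerN r #T.1 s ≤ u := lowerN_le_card_biUnion hΓ hs ⟨l, hl⟩
    have hl0 := lowerN_pos r #T.1 s
    rw [if_neg (by omega), (Nat.even_iff.2 hpar).add_one.neg_one_pow, neg_mul, neg_mul, one_mul,
      neg_le_neg_iff, one_div, inv_mul_eq_div, le_div_iff₀ hl0, mul_comm]
    gcongr
  · have hup : u ≤ upperN r #T.1 s := card_biUnion_le_upperN hΓ T.1
    rw [if_pos hpar, (Nat.odd_iff.2 hpar).add_one.neg_one_pow, one_mul, one_div, inv_mul_eq_div,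
      div_le_iff₀ (hpos.trans_le hup), mul_comm]
    gcongr

end Numberings

/-! ### Choosing a good ordering -/

section Selection

open Finset

variable {n r t s : ℕ}

/-- Recovery sets can be filled up to full size with dummy elements, without changing their
pairwise intersections. -/
theorem exists_padding (Γ : Fin t → Finset (Fin n)) (hΓ : ∀ l, #(Γ l) ≤ r + 1)
    (hs : ∀ l₁ l₂, l₁ ≠ l₂ → #(Γ l₁ ∩ Γ l₂) ≤ s + 1) :
    ∃ Γ' : Fin t → Finset (Fin n ⊕ Fin t × Fin (r + 1)),
      (∀ l, ∀ i ∈ Γ l, Sum.inl i ∈ Γ' l) ∧ (∀ l, #(Γ' l) = r + 1) ∧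
      ∀ l₁ l₂, l₁ ≠ l₂ → #(Γ' l₁ ∩ Γ' l₂) ≤ s + 1 := by
  have hpad (l : Fin t) : ∃ D : Finset (Fin (r + 1)), #D = r + 1 - #(Γ l) := by
    obtain ⟨D, -, hD⟩ := exists_subset_card_eq (s := (univ : Finset (Fin (r + 1))))
      (n := r + 1 - #(Γ l)) (by simp)
    exact ⟨D, hD⟩
  choose D hD using hpad
  refine ⟨fun l => (Γ l).disjSum ({l} ×ˢ D l), fun l i hi => inl_mem_disjSum.2 hi, fun l => ?_,
    fun l₁ l₂ hl => ?_⟩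
  · have := hΓ l
    rw [card_disjSum, card_product, card_singleton, hD]
    omega
  · have h : (Γ l₁).disjSum ({l₁} ×ˢ D l₁) ∩ (Γ l₂).disjSum ({l₂} ×ˢ D l₂) =
        (Γ l₁ ∩ Γ l₂).disjSum ∅ := by
      ext (x | ⟨l, x⟩)
      · rw [mem_inter, inl_mem_disjSum, inl_mem_disjSum, inl_mem_disjSum, mem_inter]
      · rw [mem_inter, inr_mem_disjSum, inr_mem_disjSum, inr_mem_disjSum]
        simp only [mem_product, mem_singleton, notMem_empty, iff_false]
        rintro ⟨⟨h₁, -⟩, h₂, -⟩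
        exact hl (h₁.symm.trans h₂)
    rw [h, card_disjSum, card_empty, add_zero]
    exact hs l₁ l₂ hl

/-- Averaging: the pairs `(j, σ)` are counted by `j` and by `σ`, and some `σ` reaches the mean. -/
theorem exists_numbering_p2_le {ι Ω : Type*} [Fintype Ω] [DecidableEq Ω] (e : ι → Ω)
    (Γ : Fin t → ι → Finset Ω) (hΓ : ∀ j l, e j ∈ Γ l j ∧ #(Γ l j) = r + 1)
    (hs : ∀ j l₁ l₂, l₁ ≠ l₂ → #(Γ l₁ j ∩ Γ l₂ j) ≤ s + 1) (W : Finset ι) :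
    ∃ σ : Ω ≃ Fin (Fintype.card Ω),
      #W * p2 r t s ≤ #(W.filter fun j => ∃ l, ∀ x ∈ Γ l j, σ x ≤ σ (e j)) := by
  have hcount : ∑ j ∈ W, #(univ.biUnion fun l => numberingsLast (Γ l j) (e j)) =
      ∑ σ : Ω ≃ Fin (Fintype.card Ω),
        #(W.filter fun j => ∃ l, ∀ x ∈ Γ l j, σ x ≤ σ (e j)) := by
    refine Eq.trans (sum_congr rfl fun j _ => congrArg card ?_)
      (sum_card_bipartiteAbove_eq_sum_card_bipartiteBelow (s := W)
        (fun j (σ : Ω ≃ Fin (Fintype.card Ω)) => ∃ l, ∀ x ∈ Γ l j, σ x ≤ σ (e j)))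
    ext σ
    simp [bipartiteAbove, mem_numberingsLast]
  obtain ⟨σ, -, hσ⟩ := exists_le_of_sum_le
    (s := (univ : Finset (Ω ≃ Fin (Fintype.card Ω)))) (f := fun _ => (#W : ℝ) * p2 r t s)
    (g := fun σ : Ω ≃ Fin (Fintype.card Ω) =>
      (#(W.filter fun j => ∃ l, ∀ x ∈ Γ l j, σ x ≤ σ (e j)) : ℝ))
    ⟨Fintype.equivFin Ω, mem_univ _⟩ (by
      calc ∑ _σ : Ω ≃ Fin (Fintype.card Ω), (#W : ℝ) * p2 r t s
          = ∑ _j ∈ W, p2 r t s * Fintype.card (Ω ≃ Fin (Fintype.card Ω)) := by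
            simp only [sum_const, card_univ, nsmul_eq_mul]; ring
        _ ≤ ∑ j ∈ W, (#(univ.biUnion fun l => numberingsLast (Γ l j) (e j)) : ℝ) :=
            sum_le_sum fun j _ => p2_mul_le_card_biUnion (hΓ j) (hs j)
        _ = _ := by exact_mod_cast hcount)
  exact ⟨σ, hσ⟩

/-- Some injective ordering of the qudits places at least a fraction `p2 r t s` of the qudits of
`W` last in one of their recovery sets. -/
theorem exists_ordering_p2_le (Γ : Fin t → Fin n → Finset (Fin n))
    (hΓ : ∀ l j, j ∈ Γ l j ∧ #(Γ l j) ≤ r + 1)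
    (hs : ∀ j l₁ l₂, l₁ ≠ l₂ → #(Γ l₁ j ∩ Γ l₂ j) ≤ s + 1) (W : Finset (Fin n)) :
    ∃ f : Fin n → ℕ, Function.Injective f ∧
      #W * p2 r t s ≤ #(W.filter fun j => ∃ l, ∀ i ∈ Γ l j, f i ≤ f j) := by
  choose Γ' hsub hcard hs' using fun j =>
    exists_padding (fun l => Γ l j) (fun l => (hΓ l j).2) (hs j)
  obtain ⟨σ, hσ⟩ := exists_numbering_p2_le Sum.inl (fun l j => Γ' j l)
    (fun j l => ⟨hsub j l j (hΓ l j).1, hcard j l⟩) hs' W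
  -- An element last in the padded set is last in the original one, so the dummies can be dropped.
  refine ⟨fun i => σ (Sum.inl i), fun i i' h => Sum.inl_injective (σ.injective (Fin.ext h)),
    hσ.trans (Nat.cast_le.2 (card_le_card fun j hj => ?_))⟩
  obtain ⟨hjW, l, hl⟩ := mem_filter.1 hj
  exact mem_filter.2 ⟨hjW, l, fun i hi => hl _ (hsub j l i hi)⟩

end Selection

theorem IsQLRC.exists_correctable_subset {d n r t s : ℕ} {C : Submodule ℂ (QuditSpace d n)}
    (hC : IsQLRC r t s C) (W : Finset (Fin n)) :
    ∃ V ⊆ W, Correctable C V ∧ V.card = ⌈(W.card : ℝ) * p2 r t s⌉₊ := by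
  obtain ⟨Γ, hΓ, hrec, hs⟩ := hC
  obtain ⟨f, hf, hle⟩ := exists_ordering_p2_le Γ hΓ hs W
  obtain ⟨V, hV, hcard⟩ := Finset.exists_subset_card_eq (Nat.ceil_le.2 hle)
  refine ⟨V, hV.trans (Finset.filter_subset _ _),
    correctable_of_recoversFrom_preceding f hf V fun j hj => ?_, hcard⟩
  obtain ⟨l, hl⟩ := (Finset.mem_filter.1 (hV hj)).2
  exact ⟨Γ l j, (hΓ l j).1, hrec l j, hl⟩

end QLRC

theorem mainTheorem1 (d n k r t s : ℕ) (hd : 2 ≤ d)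
    (C : Submodule ℂ (QLRC.QuditSpace d n)) (hk : QLRC.Encodes C k)
    (hC : QLRC.IsQLRC r t s C) :
    (k : ℤ) ≤ (n : ℤ) - ⌈(n : ℝ) * QLRC.p2 r t s⌉
      - ⌈((n : ℝ) - (⌈(n : ℝ) * QLRC.p2 r t s⌉ : ℝ)) * QLRC.p2 r t s⌉ := by
  have hbound (A B : Finset (Fin n)) (hA : QLRC.Correctable C A) (hB : QLRC.Correctable C B)
      (hAB : Disjoint A B) : (k : ℤ) ≤ n - A.card - B.card := by
    have h := QLRC.finrank_le_of_correctable hA hB hAB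
    rw [hk, Nat.pow_le_pow_iff_right hd, Finset.card_compl, Finset.card_union_of_disjoint hAB,
      Fintype.card_fin] at h
    have := Finset.card_le_univ (A ∪ B)
    rw [Finset.card_union_of_disjoint hAB, Fintype.card_fin] at this
    omega
  set p := QLRC.p2 r t s
  -- For `p ≤ 0` both ceilings are nonpositive and `k ≤ n` suffices. For `p > 0` the natural and
  -- integer ceilings agree.
  rcases le_or_gt p 0 with hp | hp
  · have h₀ := hbound ∅ ∅ (QLRC.correctable_empty C) (QLRC.correctable_empty C)
      (Finset.disjoint_empty_left _)
    have hn : (0 : ℝ) ≤ n := Nat.cast_nonneg n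
    have h₁ : ⌈(n : ℝ) * p⌉ ≤ 0 := by
      rw [Int.ceil_le]; simpa using mul_nonpos_of_nonneg_of_nonpos hn hp
    have h₁' : (⌈(n : ℝ) * p⌉ : ℝ) ≤ 0 := by exact_mod_cast h₁
    have h₂ : ⌈((n : ℝ) - (⌈(n : ℝ) * p⌉ : ℝ)) * p⌉ ≤ 0 := by
      rw [Int.ceil_le]
      simpa using mul_nonpos_of_nonneg_of_nonpos (by linarith : (0 : ℝ) ≤ n - ⌈(n : ℝ) * p⌉) hp
    simp only [Finset.card_empty, Nat.cast_zero] at h₀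
    linarith
  · obtain ⟨A, -, hA, hAcard⟩ := hC.exists_correctable_subset Finset.univ
    obtain ⟨B, hBA, hB, hBcard⟩ := hC.exists_correctable_subset Aᶜ
    rw [Finset.card_univ, Fintype.card_fin] at hAcard
    have hAceil : (A.card : ℤ) = ⌈(n : ℝ) * p⌉ := by
      rw [hAcard, Int.natCast_ceil_eq_ceil (by positivity)]
    have hAn : A.card ≤ n := by simpa using Finset.card_le_univ A
    have hAcompl : (Aᶜ.card : ℝ) = n - (⌈(n : ℝ) * p⌉ : ℝ) := by
      rw [Finset.card_compl, Fintype.card_fin, Nat.cast_sub hAn, ← hAceil, Int.cast_natCast]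
    have hBceil : (B.card : ℤ) = ⌈((n : ℝ) - (⌈(n : ℝ) * p⌉ : ℝ)) * p⌉ := by
      rw [hBcard, ← hAcompl, Int.natCast_ceil_eq_ceil (by positivity)]
    rw [← hAceil, ← hBceil] at *
    exact hbound A B hA hB (Finset.disjoint_right.2 fun i hi =>
      Finset.mem_compl.1 (hBA hi))
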